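/- Let $K$ be a field, $\Lambda$ a finite-dimensional $K$-algebra and $\operatorname{mod}\Lambda$ the category of finitely generated right $\Lambda$-modules. Subcategories are full, closed under isomorphisms and contain $0$. A torsion class is a subcategory of $\operatorname{mod}\Lambda$ closed under extensions and quotients; a wide subcategory is one closed under extensions, kernels and cokernels. For a collection $X$ of modules let $\mathrm{T}(X)$ be the smallest torsion class containing $X$. A torsion class is widely generated if it equals $\mathrm{T}(\mathcal W)$ for some wide subcategory $\mathcal W$, and finitely generated if it equals $\mathrm{T}(M)$ for some $M\in\operatorname{mod}\Lambda$; write $\operatorname{tors}_w\Lambda$ and $\operatorname{fg\text{-}tors}\Lambda$ for the sets of such torsion classes. A brick is a module in $\operatorname{mod}\Lambda$ whose endomorphism ring is a division ring, and a semibrick is a set $\mathcal S$ of isomorphism classes of bricks with $\operatorname{Hom}_\Lambda(S_1,S_2)=0$ for all distinct $S_1,S_2\in\mathcal S$; write $\operatorname{sbrick}\Lambda$ and $\operatorname{fin\text{-}sbrick}\Lambda$ for the sets of semibricks and of finite semibricks. For a torsion class $\mathcal T$ let $\mathcal T^\bot=\{M\in\operatorname{mod}\Lambda : \operatorname{Hom}_\Lambda(X,M)=0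 \text{ for all } X\in\mathcal T\}$. For a torsion-free class $\mathcal F$ (a subcategory closed under extensions and subobjects) let $\operatorname{MCE}(\mathcal F)$ be the set of isomorphism classes of minimal co-extending modules for $\mathcal F$, that is, of nonzero $M\in\operatorname{mod}\Lambda$ such that (i) every proper submodule of $M$ is in $\mathcal F$; (ii) if $0\to L\to X\to M\to 0$ is a non-split exact sequence in $\operatorname{mod}\Lambda$ with $L\in\mathcal F$, then $X\in\mathcal F$; (iii) $\operatorname{Hom}_\Lambda(M,Y)=0$ for all $Y\in\mathcal F$. Then $\operatorname{fg\text{-}tors}\Lambda\subseteq\operatorname{tors}_w\Lambda$. The maps $\mathcal T\mapsto\operatorname{MCE}(\mathcal T^\bot)$ and $\mathcal S\mapsto\mathrm{T}(\mathcal S)$ are mutually inverse bijections between $\operatorname{tors}_w\Lambda$ and $\operatorname{sbrick}\Lambda$, and the same formulas give mutually inverse bijections between $\operatorname{fg\text{-}tors}\Lambda$ and $\operatorname{fin\text{-}sbrick}\Lambda$, where for $\mathcal S=\{S_1,\dots,S_n\}$ one has $\mathrm{T}(\mathcal S)=\mathrm{T}(S_1\oplus\cdots\oplus S_n)$ (Ringel's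 bijection). Together with the inclusions $\operatorname{fg\text{-}tors}\Lambda\subseteq\operatorname{tors}_w\Lambda$ and $\operatorname{fin\text{-}sbrick}\Lambda\subseteq\operatorname{sbrick}\Lambda$ these bijections form a square that commutes in both horizontal directions. Consequently, every semibrick in $\operatorname{mod}\Lambda$ is finite if and only if every widely generated torsion class in $\operatorname{mod}\Lambda$ is finitely generated. -/

import Mathlib

open CategoryTheory

universe u

namespace TorsBrick

/-- Isomorphism classes of finitely generated left `R`-modules.  Finitely generated right modules
over `Λ` are obtained by taking `R = Λᵐᵒᵖ`. -/
abbrev IsoClass (R : Type u) [Ring R] : Type (u + 1) :=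
  Quotient (isIsomorphicSetoid (FGModuleCat.{u} R))

/-- The isomorphism class of a module. -/
abbrev isoClass {R : Type u} [Ring R] (M : FGModuleCat.{u} R) : IsoClass R :=
  Quotient.mk (isIsomorphicSetoid (FGModuleCat.{u} R)) M

/-- The (isomorphism-closed) full subcategory of all modules whose isomorphism class lies in `S`. -/
def objectsOf {R : Type u} [Ring R] (S : Set (IsoClass R)) : ObjectProperty (FGModuleCat.{u} R) :=
  fun M => isoClass M ∈ S

/-- `0 → L → M → N → 0`, with maps `f` and `g`, is a short exact sequence. -/
structure IsShortExact {R : Type u} [Ring R] {L M N : FGModuleCat.{u} R}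
    (f : L →ₗ[R] M) (g : M →ₗ[R] N) : Prop where
  injective : Function.Injective f
  exact : Function.Exact f g
  surjective : Function.Surjective g

/-- A full subcategory is closed under extensions. -/
def ClosedUnderExtensions {R : Type u} [Ring R] (C : ObjectProperty (FGModuleCat.{u} R)) :
    Prop :=
  ∀ (L M N : FGModuleCat.{u} R) (f : L →ₗ[R] M) (g : M →ₗ[R] N),
    IsShortExact f g → C L → C N → C M

/-- Torsion classes: (nonempty) full subcategories closed under extensions and quotients.
Closure under isomorphisms is a special case of closure under quotients. -/
structure IsTorsionClass {R : Type u} [Ring R] (T : ObjectProperty (FGModuleCat.{u} R)) :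
    Prop where
  zero : ∀ M : FGModuleCat.{u} R, Subsingleton M → T M
  ext : ClosedUnderExtensions T
  quotient : ∀ (M N : FGModuleCat.{u} R) (g : M →ₗ[R] N), Function.Surjective g → T M → T N

/-- Wide subcategories: (nonempty) full subcategories closed under extensions, kernels and
cokernels. Closure under isomorphisms is implied. -/
structure IsWide {R : Type u} [Ring R] (W : ObjectProperty (FGModuleCat.{u} R)) : Prop where
  zero : ∀ M : FGModuleCat.{u} R, Subsingleton M → W M
  ext : ClosedUnderExtensions W
  ker : ∀ (A M N : FGModuleCat.{u} R) (i : A →ₗ[R] M) (f : M →ₗ[R] N),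
    Function.Injective i → Function.Exact i f → W M → W N → W A
  coker : ∀ (M N C : FGModuleCat.{u} R) (f : M →ₗ[R] N) (p : N →ₗ[R] C),
    Function.Exact f p → Function.Surjective p → W M → W N → W C

/-- `T(X)`: the smallest torsion class containing `X`, as the intersection of all of them. -/
def torsionClosure {R : Type u} [Ring R] (X : ObjectProperty (FGModuleCat.{u} R)) :
    ObjectProperty (FGModuleCat.{u} R) :=
  fun M => ∀ T : ObjectProperty (FGModuleCat.{u} R), IsTorsionClass T → X ≤ T → T M

theorem isTorsionClass_torsionClosure {R : Type u} [Ring R]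
    (X : ObjectProperty (FGModuleCat.{u} R)) : IsTorsionClass (torsionClosure X) where
  zero M hM _ hT _ := hT.zero M hM
  ext L M N f g h hL hN T hT hX := hT.ext L M N f g h (hL T hT hX) (hN T hT hX)
  quotient M N g hg hM T hT hX := hT.quotient M N g hg (hM T hT hX)

theorem le_torsionClosure {R : Type u} [Ring R]
    (X : ObjectProperty (FGModuleCat.{u} R)) : X ≤ torsionClosure X :=
  fun M hM _ _ hX => hX M hM

/-- The set of widely generated torsion classes: those of the form `T(W)` with `W` wide. -/
def wideTors (R : Type u) [Ring R] : Set (ObjectProperty (FGModuleCat.{u} R)) :=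
  {T | IsTorsionClass T ∧ ∃ W, IsWide W ∧ T = torsionClosure W}

/-- The set of finitely generated torsion classes: those of the form `T(M)` for one module `M`. -/
def fgTors (R : Type u) [Ring R] : Set (ObjectProperty (FGModuleCat.{u} R)) :=
  {T | IsTorsionClass T ∧ ∃ M : FGModuleCat.{u} R, T = torsionClosure (fun X => X = M)}

/-- Bricks: modules whose endomorphism ring is a division ring. -/
def IsBrick {R : Type u} [Ring R] (M : FGModuleCat.{u} R) : Prop :=
  Nontrivial (Module.End R M) ∧ ∀ f : Module.End R M, f ≠ 0 → IsUnit f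

/-- The set of semibricks: sets of isomorphism classes of bricks with no nonzero homomorphisms
between distinct members. -/
def sbrick (R : Type u) [Ring R] : Set (Set (IsoClass R)) :=
  {S | (∀ M : FGModuleCat.{u} R, isoClass M ∈ S → IsBrick M) ∧
    ∀ M N : FGModuleCat.{u} R, isoClass M ∈ S → isoClass N ∈ S → isoClass M ≠ isoClass N →
      ∀ f : M →ₗ[R] N, f = 0}

/-- The set of finite semibricks. -/
def finSbrick (R : Type u) [Ring R] : Set (Set (IsoClass R)) :=
  {S | S ∈ sbrick R ∧ S.Finite}

/-- `T^⊥`: all modules `M` with `Hom(X, M) = 0` for every `X` in `T`. -/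
def rightPerp {R : Type u} [Ring R] (T : ObjectProperty (FGModuleCat.{u} R)) :
    ObjectProperty (FGModuleCat.{u} R) :=
  fun M => ∀ X : FGModuleCat.{u} R, T X → ∀ f : X →ₗ[R] M, f = 0

/-- Minimal co-extending modules for `F`: nonzero modules `M` such that every proper submodule of
`M` is in `F`, every non-split extension `0 → L → X → M → 0` with `L` in `F` has `X` in `F`, and
`Hom(M, F) = 0`. -/
structure IsMinCoextending {R : Type u} [Ring R] (F : ObjectProperty (FGModuleCat.{u} R))
    (M : FGModuleCat.{u} R) : Prop where
  nonzero : Nontrivial M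
  sub : ∀ (U : FGModuleCat.{u} R) (i : U →ₗ[R] M),
    Function.Injective i → ¬ Function.Surjective i → F U
  ext : ∀ (L X : FGModuleCat.{u} R) (f : L →ₗ[R] X) (g : X →ₗ[R] M), IsShortExact f g → F L →
    (¬ ∃ s : M →ₗ[R] X, g ∘ₗ s = LinearMap.id) → F X
  hom : ∀ Y : FGModuleCat.{u} R, F Y → ∀ f : M →ₗ[R] Y, f = 0

/-- `MCE(F)`: the set of isomorphism classes of minimal co-extending modules for `F`. -/
def MCE {R : Type u} [Ring R] (F : ObjectProperty (FGModuleCat.{u} R)) : Set (IsoClass R) :=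
  {c | ∃ M : FGModuleCat.{u} R, isoClass M = c ∧ IsMinCoextending F M}

end TorsBrick

/-! Everything rests on two facts about T = `torsionClosure (objectsOf S)` and F = T^⊥. First, if S
is a semibrick, then MCE(F) = S (`MCE_torsionClosure`). A module lies in F as soon as it receives no
nonzero map from S, and nonzero maps between members of S are isomorphisms; these two remarks give
both inclusions. So S can be recovered from T.

Second, every class in question is generated by a suitable semibrick. For T(W) with W wide, the
simple objects of W work: they form a semibrick by Schur's lemma, and every object of W is an
iterated extension of them. For T(M), a finite family of generators is shrunk until no nonzero
non-invertible homomorphism is left (`exists_finSbrick_of_multiset`).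

Conversely, T(S) is widely generated because S lies in the wide subcategory `wideKernel T` contained
in T (`torsionClosure_mem_wideTors`), and it is finitely generated for finite S by a direct sum. All
remaining claims are formal. -/

namespace TorsBrick

variable {R : Type u} [Ring R]

/-! ### Torsion closures and torsion submodules -/

theorem isoClass_eq_iff {M N : FGModuleCat.{u} R} :
    isoClass M = isoClass N ↔ Nonempty (M ≃ₗ[R] N) := by
  refine ⟨fun h => ?_, fun ⟨e⟩ => Quotient.sound ⟨e.toFGModuleCatIso⟩⟩
  obtain ⟨e⟩ := Quotient.exact h
  exact ⟨FGModuleCat.isoToLinearEquiv e⟩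

theorem torsionClosure_le {X T : ObjectProperty (FGModuleCat.{u} R)} (hT : IsTorsionClass T)
    (h : X ≤ T) : torsionClosure X ≤ T :=
  fun _ hM => hM T hT h

theorem torsionClosure_eq_of_le {X Y : ObjectProperty (FGModuleCat.{u} R)}
    (hX : X ≤ torsionClosure Y) (hY : Y ≤ torsionClosure X) :
    torsionClosure X = torsionClosure Y :=
  le_antisymm (torsionClosure_le (isTorsionClass_torsionClosure Y) hX)
    (torsionClosure_le (isTorsionClass_torsionClosure X) hY)

/-- The modules without nonzero homomorphisms to a fixed module form a torsion class. -/
theorem isTorsionClass_leftPerp (M : FGModuleCat.{u} R) :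
    IsTorsionClass (fun N : FGModuleCat.{u} R => ∀ f : N →ₗ[R] M, f = 0) where
  zero N hN f := LinearMap.ext fun x => by simp [Subsingleton.elim x 0]
  quotient A B g hg hA f := by
    ext y
    obtain ⟨x, rfl⟩ := hg y
    exact LinearMap.congr_fun (hA (f ∘ₗ g)) x
  ext L X N i g h hL hN f := by
    have hker : LinearMap.ker g ≤ LinearMap.ker f := by
      intro x hx
      obtain ⟨y, rfl⟩ := (h.exact x).1 hx
      exact LinearMap.congr_fun (hL (f ∘ₗ i)) y
    have h0 := hN ((LinearMap.ker g).liftQ f hker ∘ₗ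
      (g.quotKerEquivOfSurjective h.surjective).symm.toLinearMap)
    ext x
    have hx := LinearMap.congr_fun h0 (g x)
    have hs : (g.quotKerEquivOfSurjective h.surjective).symm (g x) =
        (LinearMap.ker g).mkQ x := by
      rw [LinearEquiv.symm_apply_eq]
      rfl
    simpa [hs] using hx

/-- Vanishing on generators suffices, since the modules with no nonzero map to `M` form a torsion
class. -/
theorem rightPerp_torsionClosure_iff {X : ObjectProperty (FGModuleCat.{u} R)}
    {M : FGModuleCat.{u} R} :
    rightPerp (torsionClosure X) M ↔ ∀ N : FGModuleCat.{u} R, X N → ∀ f : N →ₗ[R] M, f = 0 :=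
  ⟨fun h N hN => h N (le_torsionClosure X N hN),
    fun h _ hN => hN _ (isTorsionClass_leftPerp M) h⟩

namespace IsTorsionClass

variable {T : ObjectProperty (FGModuleCat.{u} R)}

theorem equiv (hT : IsTorsionClass T) {M N : FGModuleCat.{u} R} (e : M ≃ₗ[R] N) (hM : T M) :
    T N :=
  hT.quotient M N e.toLinearMap e.surjective hM

theorem mkQ (hT : IsTorsionClass T) {M : FGModuleCat.{u} R} (U : Submodule R M) (hM : T M) :
    T (FGModuleCat.of R (M ⧸ U)) :=
  hT.quotient M (FGModuleCat.of R (M ⧸ U)) U.mkQ U.mkQ_surjective hM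

theorem range (hT : IsTorsionClass T) {M N : FGModuleCat.{u} R} (f : M →ₗ[R] N) (hM : T M) :
    T (FGModuleCat.of R (LinearMap.range f)) :=
  hT.quotient M (FGModuleCat.of R (LinearMap.range f)) f.rangeRestrict
    f.surjective_rangeRestrict hM

variable [IsNoetherianRing R]

theorem of_eq {M : FGModuleCat.{u} R} {U V : Submodule R M} (h : U = V)
    (hU : T (FGModuleCat.of R U)) : T (FGModuleCat.of R V) := by
  subst h
  exact hU

theorem of_submodule (hT : IsTorsionClass T) {M : FGModuleCat.{u} R} (U : Submodule R M)
    (hU : T (FGModuleCat.of R U)) (hQ : T (FGModuleCat.of R (M ⧸ U))) : T M :=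
  hT.ext (FGModuleCat.of R U) M (FGModuleCat.of R (M ⧸ U)) U.subtype U.mkQ
    ⟨U.subtype_injective, LinearMap.exact_subtype_mkQ U, U.mkQ_surjective⟩ hU hQ

theorem sup (hT : IsTorsionClass T) {M : FGModuleCat.{u} R} {A B : Submodule R M}
    (hA : T (FGModuleCat.of R A)) (hB : T (FGModuleCat.of R B)) :
    T (FGModuleCat.of R (A ⊔ B : Submodule R M)) := by
  have hAB : T (FGModuleCat.of R (A × B)) :=
    hT.ext (FGModuleCat.of R A) (FGModuleCat.of R (A × B)) (FGModuleCat.of R B)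
      (LinearMap.inl R A B) (LinearMap.snd R A B)
      ⟨LinearMap.inl_injective, Function.Exact.inl_snd, LinearMap.snd_surjective⟩ hA hB
  have h := hT.range (N := M) (A.subtype.coprod B.subtype) hAB
  exact of_eq (by rw [LinearMap.range_coprod, A.range_subtype, B.range_subtype]) h

theorem pi (hT : IsTorsionClass T) {n : ℕ} {M : Fin n → FGModuleCat.{u} R}
    (hM : ∀ i, T (M i)) : T (FGModuleCat.of R (∀ i, M i)) := by
  have key : ∀ s : Finset (Fin n), T (FGModuleCat.of R
      (s.sup fun i => LinearMap.range (LinearMap.single R (fun i => M i) i) :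
        Submodule R (∀ i, M i))) := by
    intro s
    induction s using Finset.induction_on with
    | empty =>
      exact of_eq (M := FGModuleCat.of R (∀ i, M i)) Finset.sup_empty.symm
        (hT.zero _ inferInstance)
    | insert a s _ ih =>
      exact of_eq (M := FGModuleCat.of R (∀ i, M i)) (Finset.sup_insert ..).symm
        (hT.sup (M := FGModuleCat.of R (∀ i, M i))
          (hT.range (M := M a) (N := FGModuleCat.of R (∀ i, M i)) _ (hM a)) ih)
  have htop := of_eq (M := FGModuleCat.of R (∀ i, M i))
    ((Finset.sup_univ_eq_iSup _).trans (LinearMap.iSup_range_single R _)) (key Finset.univ)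
  exact hT.equiv (M := FGModuleCat.of R (⊤ : Submodule R (∀ i, M i)))
    (N := FGModuleCat.of R (∀ i, M i)) Submodule.topEquiv htop

/-- The torsion submodule of a submodule `U ≤ M`. -/
theorem exists_torsion_le (hT : IsTorsionClass T) {M : FGModuleCat.{u} R} (U : Submodule R M) :
    ∃ t ≤ U, T (FGModuleCat.of R t) ∧ rightPerp T (FGModuleCat.of R (U.map t.mkQ)) := by
  -- `t` is maximal among the submodules of `U` lying in `T`. The preimage of an image `V` of a
  -- member of `T` in `U / t` is an extension of `V` by `t`, so maximality forces `V = 0`.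
  obtain ⟨t, ⟨htU, hTt⟩, hmax⟩ := (wellFounded_gt (α := Submodule R M)).has_min
    {t | t ≤ U ∧ T (FGModuleCat.of R t)} ⟨⊥, bot_le, hT.zero _ inferInstance⟩
  refine ⟨t, htU, hTt, fun X hX f => ?_⟩
  set V : Submodule R (M ⧸ t) := LinearMap.range ((U.map t.mkQ).subtype ∘ₗ f) with hV
  have hTV : T (FGModuleCat.of R V) :=
    hT.range (N := FGModuleCat.of R (M ⧸ t)) ((U.map t.mkQ).subtype ∘ₗ f) hX
  have hVU : V ≤ U.map t.mkQ := by
    rintro _ ⟨x, rfl⟩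
    exact (f x).2
  have htP : t ≤ V.comap t.mkQ := t.le_comap_mkQ V
  have hTP : T (FGModuleCat.of R (V.comap t.mkQ)) := by
    refine hT.ext (FGModuleCat.of R t) (FGModuleCat.of R (V.comap t.mkQ)) (FGModuleCat.of R V)
      (Submodule.inclusion htP) (t.mkQ.restrict fun _ hx => hx)
      ⟨Submodule.inclusion_injective htP, ?_, ?_⟩ hTt hTV
    · intro x
      constructor
      · intro hx
        have hx' : (x : M) ∈ t := (Submodule.Quotient.mk_eq_zero t).1 (congrArg Subtype.val hx)
        exact ⟨⟨x, hx'⟩, rfl⟩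
      · rintro ⟨y, rfl⟩
        exact Subtype.ext ((Submodule.Quotient.mk_eq_zero t).2 y.2)
    · rintro ⟨y, hy⟩
      obtain ⟨x, rfl⟩ := t.mkQ_surjective y
      exact ⟨⟨x, hy⟩, rfl⟩
  have hPU : V.comap t.mkQ ≤ U := by
    refine (Submodule.comap_mono hVU).trans ?_
    rw [Submodule.comap_map_mkQ]
    exact sup_le htU le_rfl
  have hPt : V.comap t.mkQ = t :=
    (htP.eq_of_not_lt fun hlt => hmax _ ⟨hPU, hTP⟩ hlt).symm
  ext x
  have hx : (f x : M ⧸ t) ∈ V := ⟨x, rfl⟩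
  obtain ⟨m, hm⟩ := t.mkQ_surjective (f x)
  have hmt : m ∈ t := by
    rw [← hPt, Submodule.mem_comap, hm]
    exact hx
  exact hm.symm.trans ((Submodule.Quotient.mk_eq_zero t).2 hmt)

end IsTorsionClass

/-! ### The wide subcategory inside a torsion class -/

/-- The members `M` of `T` such that every map from a member of `T` to `M` has its kernel
in `T`. -/
def wideKernel [IsNoetherianRing R] (T : ObjectProperty (FGModuleCat.{u} R)) :
    ObjectProperty (FGModuleCat.{u} R) :=
  fun M => T M ∧ ∀ (N : FGModuleCat.{u} R) (g : N →ₗ[R] M), T N →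
    T (FGModuleCat.of R (LinearMap.ker g))

/-- For extensions, the kernel of `g` is reached in two stages: first the kernel of `p ∘ₗ g`, then
the kernel of the induced map from it to `A`. Cokernels are handled by a pullback. -/
theorem isWide_wideKernel [IsNoetherianRing R] {T : ObjectProperty (FGModuleCat.{u} R)}
    (hT : IsTorsionClass T) : IsWide (wideKernel T) where
  zero M hM := by
    refine ⟨hT.zero M hM, fun N g hN => ?_⟩
    have hg : LinearMap.ker g = ⊤ := by
      rw [LinearMap.ker_eq_top]
      exact LinearMap.ext fun x => Subsingleton.elim _ _
    exact hT.equiv (N := FGModuleCat.of R (LinearMap.ker g))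
      (Submodule.topEquiv.symm.trans (LinearEquiv.ofEq _ _ hg.symm)) hN
  ext A B C i p h hA hC := by
    refine ⟨hT.ext A B C i p h hA.1 hC.1, fun N g hN => ?_⟩
    have h1 := hC.2 N (p ∘ₗ g) hN
    have hmem : ∀ x : LinearMap.ker (p ∘ₗ g),
        (g ∘ₗ (LinearMap.ker (p ∘ₗ g)).subtype) x ∈ LinearMap.range i :=
      fun x => (h.exact _).1 x.2
    have h2 := hA.2 (FGModuleCat.of R (LinearMap.ker (p ∘ₗ g)))
      ((LinearEquiv.ofInjective i h.injective).symm.toLinearMap ∘ₗ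
        LinearMap.codRestrict _ _ hmem) h1
    refine hT.quotient _ (FGModuleCat.of R (LinearMap.ker g))
      (LinearMap.codRestrict (LinearMap.ker g)
        ((LinearMap.ker (p ∘ₗ g)).subtype ∘ₗ Submodule.subtype _) ?_) ?_ h2
    · rintro ⟨x, hx⟩
      simp only [LinearMap.mem_ker, LinearMap.comp_apply, LinearEquiv.coe_coe,
        LinearEquiv.map_eq_zero_iff] at hx
      exact congrArg Subtype.val hx
    · rintro ⟨x, hx⟩
      have hx1 : x ∈ LinearMap.ker (p ∘ₗ g) := by
        simp [LinearMap.mem_ker.1 hx]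
      refine ⟨⟨⟨x, hx1⟩, ?_⟩, rfl⟩
      simp only [LinearMap.mem_ker, LinearMap.comp_apply, LinearEquiv.coe_coe,
        LinearEquiv.map_eq_zero_iff]
      exact Subtype.ext hx
  ker A M N i f hi hex hM hN := by
    have hTA : T A := by
      have hr : LinearMap.range i = LinearMap.ker f := (LinearMap.exact_iff.1 hex).symm
      exact hT.equiv (M := FGModuleCat.of R (LinearMap.ker f))
        ((LinearEquiv.ofEq _ _ hr.symm).trans (LinearEquiv.ofInjective i hi).symm)
        (hN.2 M f hM.1)
    refine ⟨hTA, fun P g hP => ?_⟩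
    have hk : LinearMap.ker (i ∘ₗ g) = LinearMap.ker g :=
      LinearMap.ker_comp_of_ker_eq_bot g (LinearMap.ker_eq_bot.2 hi)
    exact IsTorsionClass.of_eq hk (hM.2 P (i ∘ₗ g) hP)
  coker M N C f p hex hp hM hN := by
    refine ⟨hT.quotient N C p hp hN.1, fun P g hP => ?_⟩
    -- The pullback of `g` and `p`. It is an extension of `P` by the range of `f`, hence in `T`, and
    -- its projection to `N` has kernel isomorphic to that of `g`.
    let Q : Submodule R (P × N) :=
      LinearMap.ker (g ∘ₗ LinearMap.fst R P N - p ∘ₗ LinearMap.snd R P N)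
    have hQ : ∀ x : P × N, x ∈ Q ↔ g x.1 = p x.2 := fun x => by
      simp [Q, LinearMap.mem_ker, sub_eq_zero]
    have hTQ : T (FGModuleCat.of R Q) := by
      refine hT.ext (FGModuleCat.of R (LinearMap.range f)) (FGModuleCat.of R Q) P
        (LinearMap.codRestrict Q (LinearMap.inr R P N ∘ₗ (LinearMap.range f).subtype) ?_)
        (LinearMap.fst R P N ∘ₗ Q.subtype) ⟨?_, ?_, ?_⟩ (hT.range f hM.1) hP
      · intro x
        rw [hQ]
        simpa using ((hex _).2 x.2).symm
      · intro x y hxy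
        exact Subtype.ext (congrArg (fun z : Q => (z : P × N).2) hxy)
      · rintro ⟨⟨a, b⟩, hx⟩
        rw [hQ] at hx
        constructor
        · intro h0
          have ha : a = 0 := h0
          subst ha
          have hb : b ∈ LinearMap.range f := (hex b).1 (by simpa using hx.symm)
          exact ⟨⟨b, hb⟩, rfl⟩
        · rintro ⟨y, hy⟩
          exact (congrArg (fun z : Q => (z : P × N).1) hy).symm
      · intro a
        obtain ⟨b, hb⟩ := hp (g a)
        exact ⟨⟨(a, b), (hQ _).2 hb.symm⟩, rfl⟩
    have hk := hN.2 (FGModuleCat.of R Q) (LinearMap.snd R P N ∘ₗ Q.subtype) hTQ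
    refine hT.quotient _ (FGModuleCat.of R (LinearMap.ker g))
      (LinearMap.codRestrict (LinearMap.ker g)
        (LinearMap.fst R P N ∘ₗ Q.subtype ∘ₗ Submodule.subtype _) ?_) ?_ hk
    · rintro ⟨⟨⟨a, b⟩, hx⟩, h0⟩
      have hb : b = 0 := h0
      subst hb
      have := (hQ _).1 hx
      simpa using this
    · rintro ⟨a, ha⟩
      have hQa : ((a, 0) : P × N) ∈ Q := (hQ _).2 (by simpa using ha)
      exact ⟨⟨⟨(a, 0), hQa⟩, rfl⟩, rfl⟩

/-- A non-surjective `g` has torsion-free image, hence is zero. For surjective `g`, divide out the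
torsion part `t` of the kernel: `N / t` is an extension of `M` by a torsion-free module. If it
splits, the torsion-free kernel is a quotient of `N / t`, so it vanishes; if not, `N / t` is both
torsion and torsion-free, yet maps onto `M ≠ 0`. -/
theorem IsMinCoextending.wideKernel [IsNoetherianRing R]
    {T : ObjectProperty (FGModuleCat.{u} R)} (hT : IsTorsionClass T) {M : FGModuleCat.{u} R}
    (hM : IsMinCoextending (rightPerp T) M) (hTM : T M) : wideKernel T M := by
  refine ⟨hTM, fun N g hN => ?_⟩
  by_cases hsurj : Function.Surjective g
  swap
  · have hF := hM.sub (FGModuleCat.of R (LinearMap.range g)) (LinearMap.range g).subtype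
      (LinearMap.range g).subtype_injective (fun h => hsurj fun y => by
        obtain ⟨⟨_, x, hx⟩, rfl⟩ := h y
        exact ⟨x, hx⟩)
    have h0 := hF N hN g.rangeRestrict
    have hg : LinearMap.ker g = ⊤ := by
      rw [← LinearMap.ker_rangeRestrict, h0, LinearMap.ker_zero]
    exact hT.equiv (N := FGModuleCat.of R (LinearMap.ker g))
      (Submodule.topEquiv.symm.trans (LinearEquiv.ofEq _ _ hg.symm)) hN
  obtain ⟨t, htK, hTt, hFt⟩ := hT.exists_torsion_le (LinearMap.ker g)
  have hTQ := hT.mkQ t hN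
  let π : (N ⧸ t) →ₗ[R] M := t.liftQ g htK
  have hπker : LinearMap.ker π = (LinearMap.ker g).map t.mkQ := Submodule.ker_liftQ t g htK
  have hπ : Function.Surjective π := fun y => by
    obtain ⟨x, rfl⟩ := hsurj y
    exact ⟨t.mkQ x, rfl⟩
  by_cases hsplit : ∃ s : M →ₗ[R] (N ⧸ t), π ∘ₗ s = LinearMap.id
  · obtain ⟨s, hs⟩ := hsplit
    -- `id - s ∘ π` projects `N / t` onto the kernel of `π`.
    have hmem : ∀ x : N ⧸ t, (LinearMap.id - s ∘ₗ π : (N ⧸ t) →ₗ[R] (N ⧸ t)) x ∈ (LinearMap.ker g).map t.mkQ := by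
      intro x
      have := LinearMap.congr_fun hs (π x)
      rw [← hπker]
      simpa [sub_eq_zero] using this.symm
    have h0 := hFt _ hTQ (LinearMap.codRestrict _ (LinearMap.id - s ∘ₗ π) hmem)
    have hK : LinearMap.ker g = t := by
      refine le_antisymm (fun x hx => ?_) htK
      have h1 : t.mkQ x - s (π (t.mkQ x)) = 0 :=
        congrArg Subtype.val (LinearMap.congr_fun h0 (t.mkQ x))
      have h2 : π (t.mkQ x) = 0 := hx
      rw [h2, map_zero, sub_zero] at h1
      exact (Submodule.Quotient.mk_eq_zero t).1 h1
    exact IsTorsionClass.of_eq hK.symm hTt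
  · have hF := hM.ext (FGModuleCat.of R ((LinearMap.ker g).map t.mkQ))
      (FGModuleCat.of R (N ⧸ t)) (Submodule.subtype _) π
      ⟨Submodule.subtype_injective _, fun x => by
        rw [← LinearMap.mem_ker, hπker]; simp, hπ⟩ hFt hsplit
    have h0 : (LinearMap.id : (N ⧸ t) →ₗ[R] (N ⧸ t)) = 0 := hF _ hTQ LinearMap.id
    have := hM.nonzero
    obtain ⟨y, hy⟩ := exists_ne (0 : M)
    obtain ⟨x, rfl⟩ := hπ y
    have hx : x = 0 := LinearMap.congr_fun h0 x
    exact absurd (by rw [hx, map_zero]) hy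

/-! ### Semibricks as sets of minimal co-extending modules -/

theorem IsBrick.nontrivial {M : FGModuleCat.{u} R} (hM : IsBrick M) : Nontrivial M := by
  obtain ⟨f, g, hfg⟩ := hM.1
  by_contra h
  rw [not_nontrivial_iff_subsingleton] at h
  exact hfg (LinearMap.ext fun x => Subsingleton.elim _ _)

theorem IsBrick.bijective {M : FGModuleCat.{u} R} (hM : IsBrick M) {f : M →ₗ[R] M}
    (hf : f ≠ 0) : Function.Bijective f :=
  (Module.End.isUnit_iff f).1 (hM.2 f hf)

/-- A nonzero homomorphism between members of a semibrick is bijective. -/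
theorem bijective_of_mem_sbrick {S : Set (IsoClass R)} (hS : S ∈ sbrick R)
    {M N : FGModuleCat.{u} R} (hM : isoClass M ∈ S) (hN : isoClass N ∈ S) {f : M →ₗ[R] N}
    (hf : f ≠ 0) : Function.Bijective f := by
  by_cases h : isoClass M = isoClass N
  · obtain ⟨e⟩ := isoClass_eq_iff.1 h
    have hne : e.symm.toLinearMap ∘ₗ f ≠ 0 := fun h0 => hf (LinearMap.ext fun x => by
      simpa using LinearMap.congr_fun h0 x)
    have := (hS.1 M hM).bijective hne
    have h2 : (f : M → N) = e ∘ (e.symm.toLinearMap ∘ₗ f) := by ext x; simp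
    rw [h2]
    exact e.bijective.comp this
  · exact absurd (hS.2 M N hM hN h f) hf

theorem rightPerp_torsionClosure_objectsOf_iff {S : Set (IsoClass R)} {M : FGModuleCat.{u} R} :
    rightPerp (torsionClosure (objectsOf S)) M ↔
      ∀ N : FGModuleCat.{u} R, isoClass N ∈ S → ∀ f : N →ₗ[R] M, f = 0 :=
  rightPerp_torsionClosure_iff

/-- A nonzero map from a member of `S` to `M` is bijective, so it cannot factor through a proper
submodule, and lifting it to an extension of `M` would split that extension. -/
theorem isMinCoextending_of_mem_sbrick {S : Set (IsoClass R)} (hS : S ∈ sbrick R)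
    {M : FGModuleCat.{u} R} (hM : isoClass M ∈ S) :
    IsMinCoextending (rightPerp (torsionClosure (objectsOf S))) M where
  nonzero := (hS.1 M hM).nontrivial
  hom Y hY f := rightPerp_torsionClosure_objectsOf_iff.1 hY M hM f
  sub U i hi hns := by
    rw [rightPerp_torsionClosure_objectsOf_iff]
    intro N hN f
    by_contra hf
    have hne : i ∘ₗ f ≠ 0 := fun h0 => hf (LinearMap.ext fun x => hi (by
      simpa using LinearMap.congr_fun h0 x))
    have hb := bijective_of_mem_sbrick hS hN hM hne
    exact hns (Function.Surjective.of_comp (g := f) hb.2)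
  ext L X i g h hL hns := by
    rw [rightPerp_torsionClosure_objectsOf_iff] at hL ⊢
    intro N hN f
    by_cases hgf : g ∘ₗ f = 0
    · have hmem : ∀ x, f x ∈ LinearMap.range i := fun x =>
        (h.exact _).1 (LinearMap.congr_fun hgf x)
      have h0 := hL N hN ((LinearEquiv.ofInjective i h.injective).symm.toLinearMap ∘ₗ
        LinearMap.codRestrict _ f hmem)
      ext x
      have hx := LinearMap.congr_fun h0 x
      simp only [LinearMap.comp_apply, LinearEquiv.coe_coe, LinearMap.zero_apply,
        LinearEquiv.map_eq_zero_iff] at hx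
      exact congrArg Subtype.val hx
    · have hb := bijective_of_mem_sbrick hS hN hM hgf
      refine absurd ⟨f ∘ₗ (LinearEquiv.ofBijective _ hb).symm.toLinearMap, ?_⟩ hns
      ext x
      exact (LinearEquiv.ofBijective _ hb).apply_symm_apply x

/-- Such an `M` is not torsion-free, so it receives a nonzero `f` from some `N` in the semibrick;
`f` turns out to be an isomorphism. -/
theorem mem_of_isMinCoextending [IsNoetherianRing R] {S : Set (IsoClass R)} (hS : S ∈ sbrick R)
    {M : FGModuleCat.{u} R}
    (hM : IsMinCoextending (rightPerp (torsionClosure (objectsOf S))) M) : isoClass M ∈ S := by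
  have hnF : ¬ rightPerp (torsionClosure (objectsOf S)) M := fun h => by
    have := hM.nonzero
    obtain ⟨x, hx⟩ := exists_ne (0 : M)
    exact hx (LinearMap.congr_fun (hM.hom M h LinearMap.id) x)
  rw [rightPerp_torsionClosure_objectsOf_iff] at hnF
  push Not at hnF
  obtain ⟨N, hN, f, hf⟩ := hnF
  have hsurj : Function.Surjective f := by
    by_contra hns
    have hF := hM.sub (FGModuleCat.of R (LinearMap.range f)) (LinearMap.range f).subtype
      (LinearMap.range f).subtype_injective (fun h => hns fun y => by
        obtain ⟨⟨_, x, hx⟩, rfl⟩ := h y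
        exact ⟨x, hx⟩)
    have h0 := rightPerp_torsionClosure_objectsOf_iff.1 hF N hN f.rangeRestrict
    exact hf (LinearMap.ext fun x => congrArg Subtype.val (LinearMap.congr_fun h0 x))
  have hinj : Function.Injective f := by
    -- In the split case `s ∘ f` is a nonzero endomorphism of a brick. Otherwise the extension
    -- property of `M` would make `N` torsion-free, although `N` has no nonzero map to a
    -- torsion-free module.
    by_cases hsplit : ∃ s : M →ₗ[R] N, f ∘ₗ s = LinearMap.id
    · obtain ⟨s, hs⟩ := hsplit
      have hne : s ∘ₗ f ≠ 0 := fun h0 => hf (LinearMap.ext fun x => by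
        have h1 : s (f x) = 0 := LinearMap.congr_fun h0 x
        have h2 : f (s (f x)) = f x := LinearMap.congr_fun hs (f x)
        simpa [h1] using h2.symm)
      exact Function.Injective.of_comp (f := s) ((hS.1 N hN).bijective hne).1
    · have hKs : LinearMap.ker f ≠ ⊤ := fun h => hf (LinearMap.ker_eq_top.1 h)
      have hNmin := isMinCoextending_of_mem_sbrick hS hN
      have hK := hNmin.sub (FGModuleCat.of R (LinearMap.ker f)) (LinearMap.ker f).subtype
        (LinearMap.ker f).subtype_injective (fun h => hKs (by
          rw [← (LinearMap.ker f).range_subtype]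
          exact LinearMap.range_eq_top.2 h))
      have hNF := hM.ext (FGModuleCat.of R (LinearMap.ker f)) N (LinearMap.ker f).subtype f
        ⟨(LinearMap.ker f).subtype_injective, LinearMap.exact_subtype_ker_map f, hsurj⟩ hK hsplit
      have := hNmin.nonzero
      obtain ⟨x, hx⟩ := exists_ne (0 : N)
      exact absurd (LinearMap.congr_fun (hNmin.hom N hNF LinearMap.id) x) hx
  rwa [← isoClass_eq_iff.2 ⟨LinearEquiv.ofBijective f ⟨hinj, hsurj⟩⟩]

theorem MCE_torsionClosure [IsNoetherianRing R] {S : Set (IsoClass R)} (hS : S ∈ sbrick R) :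
    MCE (rightPerp (torsionClosure (objectsOf S))) = S := by
  ext c
  constructor
  · rintro ⟨M, rfl, hM⟩
    exact mem_of_isMinCoextending hS hM
  · obtain ⟨M, rfl⟩ := Quotient.exists_rep c
    exact fun hc => ⟨M, rfl, isMinCoextending_of_mem_sbrick hS hc⟩

/-- With T = T(S), the inclusions S ⊆ `wideKernel` T ⊆ T force the wide subcategory in the middle to
generate T. -/
theorem torsionClosure_mem_wideTors [IsNoetherianRing R] {S : Set (IsoClass R)}
    (hS : S ∈ sbrick R) : torsionClosure (objectsOf S) ∈ wideTors R := by
  have hT := isTorsionClass_torsionClosure (objectsOf S)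
  refine ⟨hT, wideKernel (torsionClosure (objectsOf S)), isWide_wideKernel hT,
    le_antisymm (torsionClosure_le (isTorsionClass_torsionClosure _) fun M hM => ?_)
      (torsionClosure_le hT fun M hM => hM.1)⟩
  exact le_torsionClosure _ M ((isMinCoextending_of_mem_sbrick hS hM).wideKernel hT
    (le_torsionClosure _ M hM))

end TorsBrick

/-! ### Simple objects of wide subcategories -/

namespace TorsBrick

variable {R : Type u} [Ring R]

/-- A simple object of the subcategory `W`. -/
structure IsSimpleIn (W : ObjectProperty (FGModuleCat.{u} R)) (M : FGModuleCat.{u} R) :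
    Prop where
  mem : W M
  nontrivial : Nontrivial M
  eq_zero_or_surjective : ∀ (U : FGModuleCat.{u} R) (i : U →ₗ[R] M), Function.Injective i → W U →
    i = 0 ∨ Function.Surjective i

theorem IsWide.equiv {W : ObjectProperty (FGModuleCat.{u} R)} (hW : IsWide W)
    {M N : FGModuleCat.{u} R} (e : M ≃ₗ[R] N) (hM : W M) : W N :=
  hW.ker N M (FGModuleCat.of R PUnit) e.symm.toLinearMap 0 e.symm.injective
    (fun y => ⟨fun _ => ⟨e y, e.symm_apply_apply y⟩, fun _ => rfl⟩) hM
    (hW.zero _ (inferInstanceAs (Subsingleton PUnit)))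

theorem IsSimpleIn.equiv {W : ObjectProperty (FGModuleCat.{u} R)} (hW : IsWide W)
    {M N : FGModuleCat.{u} R} (e : M ≃ₗ[R] N) (hM : IsSimpleIn W M) : IsSimpleIn W N where
  mem := hW.equiv e hM.mem
  nontrivial := have := hM.nontrivial; e.symm.toEquiv.nontrivial
  eq_zero_or_surjective U i hi hU := by
    rcases hM.eq_zero_or_surjective U (e.symm.toLinearMap ∘ₗ i) (e.symm.injective.comp hi) hU
      with h | h
    · left
      ext x
      simpa using LinearMap.congr_fun h x
    · right
      intro y
      obtain ⟨x, hx⟩ := h (e.symm y)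
      exact ⟨x, e.symm.injective hx⟩

/-- Schur's lemma; closure of `W` under kernels makes the kernel of `f` an admissible subobject. -/
theorem IsSimpleIn.bijective [IsNoetherianRing R] {W : ObjectProperty (FGModuleCat.{u} R)}
    (hW : IsWide W) {M N : FGModuleCat.{u} R} (hM : IsSimpleIn W M) (hN : IsSimpleIn W N)
    {f : M →ₗ[R] N} (hf : f ≠ 0) : Function.Bijective f := by
  have hinj : Function.Injective f := by
    rcases hM.eq_zero_or_surjective (FGModuleCat.of R (LinearMap.ker f)) (LinearMap.ker f).subtype
      (LinearMap.ker f).subtype_injective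
      (hW.ker (FGModuleCat.of R (LinearMap.ker f)) M N _ f (LinearMap.ker f).subtype_injective
        (LinearMap.exact_subtype_ker_map f) hM.mem hN.mem) with h | h
    · rw [← LinearMap.ker_eq_bot, ← (LinearMap.ker f).range_subtype]
      exact LinearMap.range_eq_bot.2 h
    · refine absurd (LinearMap.ker_eq_top.1 ?_) hf
      rw [← (LinearMap.ker f).range_subtype]
      exact LinearMap.range_eq_top.2 h
  exact ⟨hinj, (hN.eq_zero_or_surjective M f hinj hM.mem).resolve_left hf⟩

/-- The isomorphism classes of the simple objects of `W`. -/
def simplesOf (W : ObjectProperty (FGModuleCat.{u} R)) : Set (IsoClass R) :=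
  {c | ∃ M : FGModuleCat.{u} R, isoClass M = c ∧ IsSimpleIn W M}

theorem isoClass_mem_simplesOf_iff {W : ObjectProperty (FGModuleCat.{u} R)} (hW : IsWide W)
    {M : FGModuleCat.{u} R} : isoClass M ∈ simplesOf W ↔ IsSimpleIn W M := by
  refine ⟨fun ⟨N, hNM, hN⟩ => ?_, fun h => ⟨M, rfl, h⟩⟩
  obtain ⟨e⟩ := isoClass_eq_iff.1 hNM
  exact hN.equiv hW e

theorem simplesOf_mem_sbrick [IsNoetherianRing R] {W : ObjectProperty (FGModuleCat.{u} R)}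
    (hW : IsWide W) : simplesOf W ∈ sbrick R := by
  refine ⟨fun M hM => ?_, fun M N hM hN hne f => ?_⟩
  · rw [isoClass_mem_simplesOf_iff hW] at hM
    have := hM.nontrivial
    exact ⟨inferInstance, fun f hf => (Module.End.isUnit_iff f).2 (hM.bijective hW hM hf)⟩
  · rw [isoClass_mem_simplesOf_iff hW] at hM hN
    by_contra hf
    exact hne (isoClass_eq_iff.2 ⟨LinearEquiv.ofBijective f (hM.bijective hW hN hf)⟩)

/-- The length of a module, as a natural number. -/
noncomputable def len (M : FGModuleCat.{u} R) : ℕ :=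
  (Module.length R M).toNat

variable [IsArtinianRing R]

theorem coe_len (M : FGModuleCat.{u} R) : (len M : ℕ∞) = Module.length R M :=
  ENat.natCast_toNat Module.length_ne_top

theorem len_pos (M : FGModuleCat.{u} R) [Nontrivial M] : 0 < len M := by
  have h := Module.length_pos (R := R) (M := M)
  rw [← coe_len] at h
  exact_mod_cast h

theorem len_eq_add {L M N : FGModuleCat.{u} R} {f : L →ₗ[R] M} {g : M →ₗ[R] N}
    (h : IsShortExact f g) : len M = len L + len N := by
  have := Module.length_eq_add_of_exact f g h.injective h.surjective h.exact
  rw [← coe_len, ← coe_len, ← coe_len] at this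
  exact_mod_cast this

theorem isShortExact_subtype_mkQ {M : FGModuleCat.{u} R} (U : Submodule R M) :
    IsShortExact (L := FGModuleCat.of R U) (N := FGModuleCat.of R (M ⧸ U)) U.subtype U.mkQ :=
  ⟨U.subtype_injective, LinearMap.exact_subtype_mkQ U, U.mkQ_surjective⟩

/-- Induction on length: a nonzero non-simple object of `W` has a proper nonzero subobject in `W`,
whose cokernel is again in `W`. -/
theorem le_torsionClosure_simplesOf {W : ObjectProperty (FGModuleCat.{u} R)} (hW : IsWide W) :
    W ≤ torsionClosure (objectsOf (simplesOf W)) := by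
  intro M hM
  have hT := isTorsionClass_torsionClosure (objectsOf (simplesOf W))
  induction hn : len M using Nat.strong_induction_on generalizing M with
  | _ n ih =>
  subst hn
  rcases subsingleton_or_nontrivial M with hs | hnt
  · exact hT.zero M hs
  by_cases hsimple : IsSimpleIn W M
  · exact le_torsionClosure _ M ((isoClass_mem_simplesOf_iff hW).2 hsimple)
  have hex : ∃ (U : FGModuleCat.{u} R) (i : U →ₗ[R] M), Function.Injective i ∧ W U ∧ i ≠ 0 ∧
      ¬ Function.Surjective i := by
    by_contra! hno
    exact hsimple ⟨hM, hnt, fun U i hi hU => or_iff_not_imp_left.2 (hno U i hi hU)⟩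
  obtain ⟨U, i, hi, hU, hi0, his⟩ := hex
  have hse : IsShortExact (N := FGModuleCat.of R (M ⧸ LinearMap.range i)) i
      (LinearMap.range i).mkQ :=
    ⟨hi, LinearMap.exact_map_mkQ_range i, (LinearMap.range i).mkQ_surjective⟩
  have hC := hW.coker U M _ i _ hse.exact hse.surjective hU hM
  have hUnt : Nontrivial U := by
    by_contra h
    rw [not_nontrivial_iff_subsingleton] at h
    exact hi0 (LinearMap.ext fun x => by simp [Subsingleton.elim x 0])
  have hCnt : Nontrivial (FGModuleCat.of R (M ⧸ LinearMap.range i)) :=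
    Submodule.Quotient.nontrivial_iff.2 fun h => his (LinearMap.range_eq_top.1 h)
  have hadd := len_eq_add hse
  have h1 := len_pos U
  have h2 := len_pos (FGModuleCat.of R (M ⧸ LinearMap.range i))
  exact hT.ext U M _ i _ hse (ih _ (by omega) U hU rfl) (ih _ (by omega) _ hC rfl)

theorem exists_sbrick_of_mem_wideTors {T : ObjectProperty (FGModuleCat.{u} R)}
    (hT : T ∈ wideTors R) : ∃ S ∈ sbrick R, T = torsionClosure (objectsOf S) := by
  obtain ⟨-, W, hW, rfl⟩ := hT
  refine ⟨simplesOf W, simplesOf_mem_sbrick hW,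
    torsionClosure_eq_of_le (le_torsionClosure_simplesOf hW) fun M hM => ?_⟩
  exact le_torsionClosure _ M ((isoClass_mem_simplesOf_iff hW).1 hM).mem

/-! ### Finitely generated torsion classes -/

/-- A finite family of modules generates the same torsion class as some finite semibrick: as long
as there is a nonzero non-invertible homomorphism between two members, the target can be replaced
by the cokernel, or, for an endomorphism, by the cokernel and the image. -/
theorem exists_finSbrick_of_multiset (s : Multiset (FGModuleCat.{u} R)) :
    ∃ S ∈ finSbrick R, torsionClosure (fun X => X ∈ s) = torsionClosure (objectsOf S) := by
  -- The square makes splitting a module into two nonzero pieces decrease the sum: `a² + b² + 2 < (a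
  -- + b)² + 1` for `a, b ≥ 1`. The `+ 1` makes dropping a zero module count.
  induction hn : (s.map fun M => len M ^ 2 + 1).sum using Nat.strong_induction_on
    generalizing s with
  | _ n ih =>
  subst hn
  have reduce : ∀ s' : Multiset (FGModuleCat.{u} R),
      (s'.map fun M => len M ^ 2 + 1).sum < (s.map fun M => len M ^ 2 + 1).sum →
      (∀ M ∈ s', torsionClosure (fun X => X ∈ s) M) →
      (∀ M ∈ s, torsionClosure (fun X => X ∈ s') M) →
      ∃ S ∈ finSbrick R, torsionClosure (fun X => X ∈ s) = torsionClosure (objectsOf S) := by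
    intro s' hlt h1 h2
    obtain ⟨S, hS, h⟩ := ih _ hlt s' rfl
    exact ⟨S, hS, (torsionClosure_eq_of_le h2 h1).trans h⟩
  by_cases hz : ∃ M ∈ s, Subsingleton M
  · obtain ⟨M, hM, hMs⟩ := hz
    obtain ⟨t, rfl⟩ := Multiset.exists_cons_of_mem hM
    refine reduce t (by simp) (fun N hN => le_torsionClosure _ N (Multiset.mem_cons_of_mem hN))
      fun N hN => ?_
    rcases Multiset.mem_cons.1 hN with rfl | hN
    · exact (isTorsionClass_torsionClosure _).zero N hMs
    · exact le_torsionClosure _ N hN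
  by_cases hend : ∃ M ∈ s, ∃ f : M →ₗ[R] M, f ≠ 0 ∧ ¬ Function.Surjective f
  · obtain ⟨M, hM, f, hf, hfs⟩ := hend
    obtain ⟨t, rfl⟩ := Multiset.exists_cons_of_mem hM
    let I := FGModuleCat.of R (LinearMap.range f)
    let C := FGModuleCat.of R (M ⧸ LinearMap.range f)
    have hInt : Nontrivial I :=
      (Submodule.nontrivial_iff_ne_bot).2 fun h => hf (LinearMap.range_eq_bot.1 h)
    have hCnt : Nontrivial C :=
      Submodule.Quotient.nontrivial_iff.2 fun h => hfs (LinearMap.range_eq_top.1 h)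
    have hlen : len M = len I + len C := len_eq_add (isShortExact_subtype_mkQ _)
    refine reduce (I ::ₘ C ::ₘ t) ?_ (fun N hN => ?_) fun N hN => ?_
    · have h1 := len_pos I
      have h2 := len_pos C
      simp only [Multiset.map_cons, Multiset.sum_cons, hlen]
      nlinarith [Nat.mul_le_mul h1 h2]
    · have hT := isTorsionClass_torsionClosure fun X => X ∈ M ::ₘ t
      have hTM := le_torsionClosure (fun X => X ∈ M ::ₘ t) M (Multiset.mem_cons_self M t)
      rcases Multiset.mem_cons.1 hN with rfl | hN
      · exact hT.range f hTM
      rcases Multiset.mem_cons.1 hN with rfl | hN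
      · exact hT.mkQ _ hTM
      · exact le_torsionClosure _ N (Multiset.mem_cons_of_mem hN)
    · rcases Multiset.mem_cons.1 hN with rfl | hN
      · exact (isTorsionClass_torsionClosure _).of_submodule (LinearMap.range f)
          (le_torsionClosure _ I (by simp)) (le_torsionClosure _ C (by simp))
      · exact le_torsionClosure _ N (by simp [hN])
  -- The map may be an isomorphism between distinct objects; the cokernel is then zero and is
  -- discarded at a later stage. `N` is recovered as an extension of the cokernel by an image of
  -- `M`.
  by_cases hhom : ∃ M ∈ s, ∃ N ∈ s, M ≠ N ∧ ∃ f : M →ₗ[R] N, f ≠ 0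
  · obtain ⟨M, hM, N, hN, hne, f, hf⟩ := hhom
    obtain ⟨t, rfl⟩ := Multiset.exists_cons_of_mem hM
    obtain ⟨t, rfl⟩ := Multiset.exists_cons_of_mem
      ((Multiset.mem_cons.1 hN).resolve_left hne.symm)
    let I := FGModuleCat.of R (LinearMap.range f)
    let C := FGModuleCat.of R (N ⧸ LinearMap.range f)
    have hInt : Nontrivial I :=
      (Submodule.nontrivial_iff_ne_bot).2 fun h => hf (LinearMap.range_eq_bot.1 h)
    have hlen : len N = len I + len C := len_eq_add (isShortExact_subtype_mkQ _)
    refine reduce (M ::ₘ C ::ₘ t) ?_ (fun X hX => ?_) fun X hX => ?_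
    · have h1 := len_pos I
      simp only [Multiset.map_cons, Multiset.sum_cons, hlen]
      nlinarith
    · have hTN := le_torsionClosure (fun X => X ∈ M ::ₘ N ::ₘ t) N hN
      rcases Multiset.mem_cons.1 hX with rfl | hX
      · exact le_torsionClosure _ X hM
      rcases Multiset.mem_cons.1 hX with rfl | hX
      · exact (isTorsionClass_torsionClosure _).mkQ _ hTN
      · exact le_torsionClosure _ X (by simp [hX])
    · rcases Multiset.mem_cons.1 hX with rfl | hX
      · exact le_torsionClosure _ X (by simp)
      rcases Multiset.mem_cons.1 hX with rfl | hX
      · have hT := isTorsionClass_torsionClosure fun X => X ∈ M ::ₘ C ::ₘ t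
        exact hT.of_submodule (LinearMap.range f)
          (hT.range f (le_torsionClosure _ M (by simp))) (le_torsionClosure _ C (by simp))
      · exact le_torsionClosure _ X (by simp [hX])
  push Not at hz hend hhom
  -- No reduction applies. Repeated copies of one object merge under `isoClass`.
  refine ⟨isoClass '' {M | M ∈ s}, ⟨⟨fun M hM => ?_, fun M N hM hN hne f => ?_⟩,
    Set.Finite.image _ s.finite_toSet⟩,
    torsionClosure_eq_of_le (fun M hM => ?_) fun M hM => ?_⟩
  · obtain ⟨N, hN, hNM⟩ := hM
    obtain ⟨e⟩ := isoClass_eq_iff.1 hNM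
    have := hz N hN
    have hMnt : Nontrivial M := e.symm.toEquiv.nontrivial
    refine ⟨inferInstance, fun f hf => (Module.End.isUnit_iff f).2 ?_⟩
    have hsurj := hend N hN (e.symm.toLinearMap ∘ₗ f ∘ₗ e.toLinearMap) fun h => hf (by
      ext x
      simpa using LinearMap.congr_fun h (e.symm x))
    refine IsNoetherian.bijective_of_surjective_endomorphism f fun y => ?_
    obtain ⟨x, hx⟩ := hsurj (e.symm y)
    exact ⟨e x, e.symm.injective hx⟩
  · obtain ⟨M', hM', hMM⟩ := hM
    obtain ⟨N', hN', hNN⟩ := hN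
    obtain ⟨e⟩ := isoClass_eq_iff.1 hMM
    obtain ⟨e'⟩ := isoClass_eq_iff.1 hNN
    have h0 := hhom M' hM' N' hN' (fun h => hne (by rw [← hMM, ← hNN, h]))
      (e'.symm.toLinearMap ∘ₗ f ∘ₗ e.toLinearMap)
    ext x
    simpa using LinearMap.congr_fun h0 (e.symm x)
  · exact le_torsionClosure _ M ⟨M, hM, rfl⟩
  · obtain ⟨N, hN, hNM⟩ := hM
    obtain ⟨e⟩ := isoClass_eq_iff.1 hNM
    exact (isTorsionClass_torsionClosure _).equiv e (le_torsionClosure _ N hN)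

theorem exists_finSbrick_of_mem_fgTors {T : ObjectProperty (FGModuleCat.{u} R)}
    (hT : T ∈ fgTors R) : ∃ S ∈ finSbrick R, T = torsionClosure (objectsOf S) := by
  obtain ⟨-, M, rfl⟩ := hT
  simpa using exists_finSbrick_of_multiset {M}

theorem torsionClosure_objectsOf_range {n : ℕ} (M : Fin n → FGModuleCat.{u} R) :
    torsionClosure (objectsOf (Set.range fun i => isoClass (M i))) =
      torsionClosure (fun X => X = FGModuleCat.of R (∀ i, M i)) := by
  refine torsionClosure_eq_of_le (fun N hN => ?_) fun N hN => ?_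
  · obtain ⟨i, hi⟩ := hN
    obtain ⟨e⟩ := isoClass_eq_iff.1 hi
    have hT := isTorsionClass_torsionClosure (fun X => X = FGModuleCat.of R (∀ i, M i))
    exact hT.equiv e (hT.quotient (FGModuleCat.of R (∀ i, M i)) (M i) (LinearMap.proj i)
      (LinearMap.proj_surjective i) (le_torsionClosure _ _ rfl))
  · subst hN
    exact (isTorsionClass_torsionClosure _).pi fun i => le_torsionClosure _ _ ⟨i, rfl⟩

theorem torsionClosure_mem_fgTors {S : Set (IsoClass R)} (hS : S.Finite) :
    torsionClosure (objectsOf S) ∈ fgTors R := by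
  obtain ⟨n, c, -, rfl⟩ := hS.fin_param
  refine ⟨isTorsionClass_torsionClosure _, FGModuleCat.of R (∀ i, (c i).out), ?_⟩
  rw [← torsionClosure_objectsOf_range]
  congr
  ext i
  exact (Quotient.out_eq (c i)).symm

/-! ### The bijections -/

theorem torsionClosure_MCE_of_mem_wideTors {T : ObjectProperty (FGModuleCat.{u} R)}
    (hT : T ∈ wideTors R) : torsionClosure (objectsOf (MCE (rightPerp T))) = T := by
  obtain ⟨S, hS, rfl⟩ := exists_sbrick_of_mem_wideTors hT
  rw [MCE_torsionClosure hS]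

theorem MCE_mem_sbrick {T : ObjectProperty (FGModuleCat.{u} R)} (hT : T ∈ wideTors R) :
    MCE (rightPerp T) ∈ sbrick R := by
  obtain ⟨S, hS, rfl⟩ := exists_sbrick_of_mem_wideTors hT
  rwa [MCE_torsionClosure hS]

theorem MCE_mem_finSbrick {T : ObjectProperty (FGModuleCat.{u} R)} (hT : T ∈ fgTors R) :
    MCE (rightPerp T) ∈ finSbrick R := by
  obtain ⟨S, hS, rfl⟩ := exists_finSbrick_of_mem_fgTors hT
  rwa [MCE_torsionClosure hS.1]

variable (R)

theorem fgTors_subset_wideTors : fgTors R ⊆ wideTors R := by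
  intro T hT
  obtain ⟨S, hS, rfl⟩ := exists_finSbrick_of_mem_fgTors hT
  exact torsionClosure_mem_wideTors hS.1

/-- Widely generated torsion classes correspond to semibricks. -/
noncomputable def wideTorsEquiv : wideTors R ≃ sbrick R where
  toFun T := ⟨MCE (rightPerp T.1), MCE_mem_sbrick T.2⟩
  invFun S := ⟨torsionClosure (objectsOf S.1), torsionClosure_mem_wideTors S.2⟩
  left_inv T := Subtype.ext (torsionClosure_MCE_of_mem_wideTors T.2)
  right_inv S := Subtype.ext (MCE_torsionClosure S.2)

/-- Finitely generated torsion classes correspond to finite semibricks. -/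
noncomputable def fgTorsEquiv : fgTors R ≃ finSbrick R where
  toFun T := ⟨MCE (rightPerp T.1), MCE_mem_finSbrick T.2⟩
  invFun S := ⟨torsionClosure (objectsOf S.1), torsionClosure_mem_fgTors S.2.2⟩
  left_inv T := Subtype.ext (torsionClosure_MCE_of_mem_wideTors (fgTors_subset_wideTors R T.2))
  right_inv S := Subtype.ext (MCE_torsionClosure S.2.1)

theorem forall_sbrick_finite_iff :
    (∀ S ∈ sbrick R, S.Finite) ↔ ∀ T ∈ wideTors R, T ∈ fgTors R := by
  refine ⟨fun h T hT => ?_, fun h S hS => ?_⟩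
  · rw [← torsionClosure_MCE_of_mem_wideTors hT]
    exact torsionClosure_mem_fgTors (h _ (MCE_mem_sbrick hT))
  · rw [← MCE_torsionClosure hS]
    exact (MCE_mem_finSbrick (h _ (torsionClosure_mem_wideTors hS))).2

end TorsBrick

theorem corollary3p5 (K : Type*) [Field K] (Λ : Type u) [Ring Λ] [Algebra K Λ]
    [Module.Finite K Λ] :
    (∃ (hfg : TorsBrick.fgTors Λᵐᵒᵖ ⊆ TorsBrick.wideTors Λᵐᵒᵖ)
      (hfin : TorsBrick.finSbrick Λᵐᵒᵖ ⊆ TorsBrick.sbrick Λᵐᵒᵖ)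
      (φ : TorsBrick.wideTors Λᵐᵒᵖ ≃ TorsBrick.sbrick Λᵐᵒᵖ)
      (ψ : TorsBrick.fgTors Λᵐᵒᵖ ≃ TorsBrick.finSbrick Λᵐᵒᵖ),
      -- the upper horizontal maps
      (∀ T, (φ T : Set (TorsBrick.IsoClass Λᵐᵒᵖ)) =
        TorsBrick.MCE (TorsBrick.rightPerp (T : ObjectProperty (FGModuleCat.{u} Λᵐᵒᵖ)))) ∧
      (∀ S, (φ.symm S : ObjectProperty (FGModuleCat.{u} Λᵐᵒᵖ)) =
        TorsBrick.torsionClosure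
          (TorsBrick.objectsOf (S : Set (TorsBrick.IsoClass Λᵐᵒᵖ)))) ∧
      -- the lower horizontal maps
      (∀ T, (ψ T : Set (TorsBrick.IsoClass Λᵐᵒᵖ)) =
        TorsBrick.MCE (TorsBrick.rightPerp (T : ObjectProperty (FGModuleCat.{u} Λᵐᵒᵖ)))) ∧
      (∀ S, (ψ.symm S : ObjectProperty (FGModuleCat.{u} Λᵐᵒᵖ)) =
        TorsBrick.torsionClosure
          (TorsBrick.objectsOf (S : Set (TorsBrick.IsoClass Λᵐᵒᵖ)))) ∧
      -- the lower left-pointing map is `{M₁, …, Mₙ} ↦ T(M₁ ⊕ ⋯ ⊕ Mₙ)`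
      (∀ (S : TorsBrick.finSbrick Λᵐᵒᵖ) (n : ℕ) (M : Fin n → FGModuleCat.{u} Λᵐᵒᵖ),
        (S : Set (TorsBrick.IsoClass Λᵐᵒᵖ)) =
          Set.range (fun i => TorsBrick.isoClass (M i)) →
        (ψ.symm S : ObjectProperty (FGModuleCat.{u} Λᵐᵒᵖ)) =
          TorsBrick.torsionClosure (fun X => X = FGModuleCat.of Λᵐᵒᵖ (∀ i, M i))) ∧
      -- the square commutes in both horizontal directions
      (∀ T, Set.inclusion hfin (ψ T) = φ (Set.inclusion hfg T)) ∧
      (∀ S, Set.inclusion hfg (ψ.symm S) = φ.symm (Set.inclusion hfin S))) ∧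
    ((∀ S ∈ TorsBrick.sbrick Λᵐᵒᵖ, S.Finite) ↔
      (∀ T ∈ TorsBrick.wideTors Λᵐᵒᵖ, T ∈ TorsBrick.fgTors Λᵐᵒᵖ)) := by
  have : Module.Finite K Λᵐᵒᵖ := inferInstance
  -- Finite dimension enters only here: it gives all finitely generated modules finite length.
  have : IsArtinianRing Λᵐᵒᵖ := IsArtinianRing.of_finite K _
  refine ⟨⟨TorsBrick.fgTors_subset_wideTors _, fun S hS => hS.1, TorsBrick.wideTorsEquiv _,
    TorsBrick.fgTorsEquiv _, fun _ => rfl, fun _ => rfl, fun _ => rfl, fun _ => rfl,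
    fun S n M hM => ?_, fun _ => rfl, fun _ => rfl⟩, TorsBrick.forall_sbrick_finite_iff _⟩
  rw [← TorsBrick.torsionClosure_objectsOf_range, ← hM]
  rfl
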